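/- Let $p$ be a prime, let $G$ be an abelian $p$-group, and let $G^1=\bigcap_{m>0}p^mG$. For $y\in G$ let $h(y)$ denote the (generalized) $p$-height of $y$ in $G$: $h(y)$ is the ordinal $\sigma$ with $y\in p^\sigma G\setminus p^{\sigma+1}G$, and $h(y)=\infty$ if $y$ lies in $p^\sigma G$ for all ordinals $\sigma$; here $p^0G=G$, $p^{\sigma+1}G=p(p^\sigma G)$, and $p^\sigma G=\bigcap_{\tau<\sigma}p^\tau G$ for limit ordinals $\sigma$. Let $x\in G$ be an element of exponent $n$ (that is, of order $p^n$) such that $\langle x\rangle\cap G^1=\{0\}$, and let $$U(x)=(h_0,h_1,\dots)=(h(x),h(px),\dots,h(p^{n-1}x),\infty,\infty,\dots)$$ be its Ulm sequence. With the convention $h_{-1}=-1$, we say that $U(x)$ has a gap before $k\ge 0$ if $h_k>h_{k-1}+1$; the gap before $k=n$ is called trivial, every other gap non-trivial. Then the following are equivalent: 1. every homomorphism $\langle x\rangle\to G$ extends to an endomorphism of $G$, i.e. $\langle x\rangle\in\mathcal Q(G)$; 2. every monomorphism $\langle x\rangle\to G$ extends to an endomorphism of $G$, i.e. $\langle x\rangle\in\mathcal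 P(G)$; 3. $U(x)$ has at most one non-trivial gap, and if a non-trivial gap occurs before the index $k\ge 0$ and $h(p^kx)=k+\ell$, then $G$ has no cyclic direct summand of exponent $e$ (that is, of order $p^e$) with $k+1\le e\le n+\ell-1$. -/

import Mathlib

noncomputable section

namespace AbPGroup

universe u

variable {G : Type u} [AddCommGroup G]

/-- The additively written abelian group `G` is a `p`-group: every element has order a power
of `p`. -/
def IsAddPGroup (p : ℕ) (G : Type u) [AddCommGroup G] : Prop :=
  ∀ g : G, ∃ k : ℕ, p ^ k • g = 0

/-- The set `Q(G)` of subgroups `N` such that every homomorphism `N → G` extends to an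
endomorphism of `G`. -/
def Q (G : Type u) [AddCommGroup G] : Set (AddSubgroup G) :=
  {N | ∀ f : N →+ G, ∃ g : G →+ G, ∀ y : N, g y = f y}

/-- The set `P(G)` of subgroups `N` such that every monomorphism `N → G` extends to an
endomorphism of `G`. -/
def P (G : Type u) [AddCommGroup G] : Set (AddSubgroup G) :=
  {N | ∀ f : N →+ G, Function.Injective f → ∃ g : G →+ G, ∀ y : N, g y = f y}

/-- The first Ulm subgroup `G¹ = ⋂_{m > 0} p^m G` (for a `p`-group `G`). -/
def firstUlm (p : ℕ) (G : Type u) [AddCommGroup G] : AddSubgroup G :=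
  ⨅ m : ℕ, ⨅ _ : 0 < m, (nsmulAddMonoidHom (α := G) (p ^ m)).range

/-- The subgroups `p^σ G` for ordinals `σ`: `p^0 G = G`, `p^(σ+1) G = p (p^σ G)`, and
`p^σ G = ⋂_{τ < σ} p^τ G` for limit ordinals `σ`. -/
def pPow (p : ℕ) (G : Type u) [AddCommGroup G] (σ : Ordinal.{u}) : AddSubgroup G :=
  Ordinal.limitRecOn σ ⊤ (fun _ H => H.map (nsmulAddMonoidHom (α := G) p))
    (fun σ _ H => ⨅ τ : Ordinal.{u}, ⨅ h : τ < σ, H τ h)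

open Classical in
/-- The (generalized) height of `y` at `p`: the ordinal `σ` with `y ∈ p^σ G` and
`y ∉ p^(σ+1) G`, that is, the least `σ` with `y ∉ p^(σ+1) G`, and `⊤` (infinity) if `y` lies in
every `p^σ G`, i.e. in the divisible part of a `p`-group. -/
def height (p : ℕ) (y : G) : WithTop Ordinal.{u} :=
  if ∀ σ : Ordinal.{u}, y ∈ pPow p G σ then ⊤
  else ((sInf {σ : Ordinal.{u} | y ∉ pPow p G (σ + 1)} : Ordinal.{u}) : WithTop Ordinal.{u})

/-- The Ulm sequence `U(x) = (h(x), h(px), h(p²x), …)`. If `x` has exponent `n`, the entries from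
index `n` on are heights of `0`, hence `⊤`. -/
def ulmSeq (p : ℕ) (x : G) : ℕ → WithTop Ordinal.{u} :=
  fun i => height p (p ^ i • x)

/-- The sequence `U` has a gap before `k`: `U k > U (k-1) + 1`, where `U (-1) = -1`, so that for
`k = 0` the condition reads `U 0 > 0`. -/
def HasGapBefore (U : ℕ → WithTop Ordinal.{u}) : ℕ → Prop
  | 0 => 0 < U 0
  | k + 1 => U k + 1 < U (k + 1)

/-- A gap of an Ulm sequence `U` of length `n` that is not the trivial gap before `n`. -/
def HasNontrivialGapBefore (U : ℕ → WithTop Ordinal.{u}) (n k : ℕ) : Prop :=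
  HasGapBefore U k ∧ k ≠ n

/-- `N` is a direct summand of `G`. -/
def IsDirectSummand (N : AddSubgroup G) : Prop :=
  ∃ K : AddSubgroup G, IsCompl N K

/-- `G` has a cyclic direct summand of exponent `e`, i.e. one of order `p ^ e`. -/
def HasCyclicSummandOfExponent (p : ℕ) (G : Type u) [AddCommGroup G] (e : ℕ) : Prop :=
  ∃ z : G, addOrderOf z = p ^ e ∧ IsDirectSummand (AddSubgroup.zmultiples z)

end AbPGroup

end

namespace AbPGroup

universe u

variable {G : Type u} [AddCommGroup G]

/-! ### Homomorphisms into and out of finite cyclic groups. -/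

section Characters

/-! Since `⟨x⟩` meets `G¹` trivially, all `p^i x` with `i < n` have finite heights, so Ulm sequences
reduce to divisibility by powers of `p`.

3 → 1: without a non-trivial gap, `⟨x⟩` is a summand (`exists_endo_of_pure`). With one gap before
`k`, where the height is `k + l`, `exists_coordinates` splits `x = a + p^l b`, so `x` can be sent to
any `y` with `p^n y = 0` and `p^k y ∈ p^(k+l) G`. If that divisibility failed, some `p^i y` would
jump in height and produce a forbidden cyclic summand (`exists_pow_smul_eq_of_no_summand`).

2 → 3: an endomorphism `x ↦ y` forces `p^k y ∈ p^(k+l) G`. A generator of a forbidden summand yields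
a `y` of order `p^n` violating this (`not_hasCyclicSummand_of_forall_exists_endo`), and a second gap
itself creates such a summand. -/

/-- The embedding of `ZMod N` in `ℚ / ℤ` with image the `N`-torsion. -/
lemma exists_zmod_embedding (N : ℕ) (hN : N ≠ 0) :
    ∃ ι : ZMod N →+ AddCircle (1 : ℚ), Function.Injective ι ∧
      ∀ t : AddCircle (1 : ℚ), N • t = 0 → ∃ c, ι c = t := by
  have hN' : (N : ℚ) ≠ 0 := by exact_mod_cast hN
  have h0 : (zmultiplesHom (AddCircle (1 : ℚ)) (((1 / N : ℚ)) : AddCircle (1 : ℚ))) (N : ℤ) = 0 := by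
    rw [zmultiplesHom_apply, ← AddCircle.coe_zsmul, AddCircle.coe_eq_zero_iff]
    exact ⟨1, by simp [hN']⟩
  have hι : ∀ k : ℤ, ZMod.lift N ⟨_, h0⟩ (k : ZMod N) = ((k • (1 / N : ℚ) : ℚ) : AddCircle (1 : ℚ)) := by
    intro k
    rw [ZMod.lift_coe, AddCircle.coe_zsmul]
    rfl
  refine ⟨ZMod.lift N ⟨_, h0⟩, ?_, ?_⟩
  · rw [injective_iff_map_eq_zero]
    intro a ha
    obtain ⟨k, rfl⟩ := ZMod.intCast_surjective a
    rw [hι, AddCircle.coe_eq_zero_iff] at ha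
    obtain ⟨j, hj⟩ := ha
    rw [ZMod.intCast_zmod_eq_zero_iff_dvd _ N]
    refine ⟨j, ?_⟩
    simp only [zsmul_eq_mul, mul_one] at hj
    field_simp at hj
    have : (k : ℚ) = ((N * j : ℤ) : ℚ) := by push_cast; linarith
    exact_mod_cast this
  · intro t ht
    obtain ⟨q, rfl⟩ := QuotientAddGroup.mk_surjective t
    change N • ((q : ℚ) : AddCircle (1 : ℚ)) = 0 at ht
    rw [← AddCircle.coe_nsmul, AddCircle.coe_eq_zero_iff] at ht
    obtain ⟨k, hk⟩ := ht
    refine ⟨k, ?_⟩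
    rw [hι]
    congr 1
    simp only [zsmul_eq_mul, nsmul_eq_mul, mul_one] at hk ⊢
    field_simp
    linarith

/-- If `p ^ (e - 1) z` is not divisible by `p ^ e`, then `z` is the preimage of a generator under
some homomorphism onto the cyclic group of order `p ^ e`. -/
lemma exists_hom_zmod_eq_one (p : ℕ) [hp : Fact p.Prime] (e : ℕ) (z : G)
    (hz : ∀ j, j + 1 = e → ∀ w : G, p ^ e • w ≠ p ^ j • z) :
    ∃ ψ : G →+ ZMod (p ^ e), ψ z = 1 := by
  obtain _ | j := e
  · exact ⟨0, Subsingleton.elim (α := ZMod 1) _ _⟩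
  have hz := hz j rfl
  have hN : p ^ (j + 1) ≠ 0 := pow_ne_zero _ hp.out.ne_zero
  let R := (nsmulAddMonoidHom (α := G) (p ^ (j + 1))).range
  have hne : (QuotientAddGroup.mk (p ^ j • z) : G ⧸ R) ≠ 0 := by
    rw [Ne, QuotientAddGroup.eq_zero_iff]
    rintro ⟨w, hw⟩
    exact hz w hw
  -- A character of `G / p^(j+1) G` takes values in the `p^(j+1)`-torsion of `ℚ / ℤ`, hence in a
  -- copy of `ZMod (p ^ (j + 1))`.
  obtain ⟨χ, hχ⟩ := CharacterModule.exists_character_apply_ne_zero_of_ne_zero hne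
  obtain ⟨ι, hι, hsurj⟩ := exists_zmod_embedding _ hN
  have htors : ∀ g : G, p ^ (j + 1) • χ (QuotientAddGroup.mk g) = 0 := by
    intro g
    have hg : (QuotientAddGroup.mk (p ^ (j + 1) • g) : G ⧸ R) = 0 :=
      (QuotientAddGroup.eq_zero_iff _).2 ⟨g, rfl⟩
    rw [← map_nsmul, ← QuotientAddGroup.mk_nsmul, hg, map_zero]
  choose c hc using fun g => hsurj _ (htors g)
  let φ : G →+ ZMod (p ^ (j + 1)) := AddMonoidHom.mk' c (by
    intro a b
    apply hι
    rw [map_add, hc, hc, hc, QuotientAddGroup.mk_add, map_add])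
  have hφ : p ^ j • φ z ≠ 0 := by
    intro h
    apply hχ
    rw [QuotientAddGroup.mk_nsmul, map_nsmul, ← hc, ← map_nsmul]
    change ι (p ^ j • φ z) = 0
    rw [h, map_zero]
  have : NeZero (p ^ (j + 1)) := ⟨hN⟩
  have hu : IsUnit (φ z) := by
    rw [← ZMod.natCast_zmod_val (φ z), ZMod.isUnit_iff_coprime]
    apply Nat.Coprime.pow_right
    rw [Nat.coprime_comm, hp.out.coprime_iff_not_dvd]
    rintro ⟨d, hd⟩
    apply hφ
    rw [← ZMod.natCast_zmod_val (φ z), hd, nsmul_eq_mul, ← Nat.cast_mul, ZMod.natCast_eq_zero_iff]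
    exact ⟨d, by ring⟩
  obtain ⟨u, hu⟩ := hu
  refine ⟨(AddMonoidHom.mulLeft (↑u⁻¹ : ZMod (p ^ (j + 1)))).comp φ, ?_⟩
  simp [← hu]

/-- The homomorphism from `ZMod N` that sends `1` to a given element killed by `N`. -/
lemma exists_zmod_hom_apply_one (N : ℕ) (z : G) (hz : N • z = 0) :
    ∃ f : ZMod N →+ G, ∀ k : ℤ, f k = k • z := by
  have h0 : zmultiplesHom G z (N : ℤ) = 0 := by
    rw [zmultiplesHom_apply, natCast_zsmul, hz]
  exact ⟨ZMod.lift N ⟨_, h0⟩, fun k => by rw [ZMod.lift_coe]; rfl⟩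

end Characters

/-! ### Cyclic direct summands and heights. -/

section Summands

variable {p : ℕ} [hp : Fact p.Prime]

lemma addOrderOf_eq_pow {e : ℕ} {c : G} (h0 : p ^ e • c = 0)
    (h1 : ∀ j, j + 1 = e → p ^ j • c ≠ 0) : addOrderOf c = p ^ e := by
  obtain _ | j := e
  · simpa using h0
  · exact addOrderOf_eq_prime_pow (h1 j rfl) h0

/-- An element of order `p ^ e` whose socle multiple has height `e - 1` generates a summand. -/
lemma hasCyclicSummand_of_pure {e : ℕ} {c : G} (h0 : p ^ e • c = 0)
    (h1 : ∀ j, j + 1 = e → ∀ w : G, p ^ e • w ≠ p ^ j • c) :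
    HasCyclicSummandOfExponent p G e := by
  obtain ⟨ψ, hψ⟩ := exists_hom_zmod_eq_one p e c h1
  have key : ∀ k : ℤ, ψ (k • c) = k := fun k => by rw [map_zsmul, hψ, zsmul_one]
  refine ⟨c, addOrderOf_eq_pow h0 fun j hj h => h1 j hj 0 (by rw [h, smul_zero]), ψ.ker, ?_⟩
  rw [isCompl_iff, AddSubgroup.disjoint_def, codisjoint_iff, eq_top_iff]
  refine ⟨?_, ?_⟩
  · rintro _ ⟨k, rfl⟩ hk
    change k • c ∈ ψ.ker at hk
    rw [AddMonoidHom.mem_ker, key, ZMod.intCast_zmod_eq_zero_iff_dvd _ (p ^ e)] at hk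
    obtain ⟨d, rfl⟩ := hk
    change (((p ^ e : ℕ) : ℤ) * d) • c = 0
    rw [mul_comm, mul_zsmul, natCast_zsmul, h0, smul_zero]
  · intro g _
    obtain ⟨k, hk⟩ := ZMod.intCast_surjective (ψ g)
    rw [← add_sub_cancel (k • c) g]
    refine AddSubgroup.add_mem_sup ⟨k, rfl⟩ ?_
    rw [AddMonoidHom.mem_ker, map_sub, key, hk, sub_self]

/-- A generator `c` of a cyclic summand of order `p ^ e` has `p ^ j c` of height `j` for `j < e`. -/
lemma HasCyclicSummandOfExponent.exists_generator {e : ℕ} (h : HasCyclicSummandOfExponent p G e) :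
    ∃ c : G, p ^ e • c = 0 ∧ ∀ j, j < e → ∀ w : G, p ^ (j + 1) • w ≠ p ^ j • c := by
  obtain ⟨c, hc, K, hK⟩ := h
  have h0 : p ^ e • c = 0 := by rw [← hc, addOrderOf_nsmul_eq_zero]
  refine ⟨c, h0, fun j hj w hw => ?_⟩
  have hw' : w ∈ AddSubgroup.zmultiples c ⊔ K := by rw [hK.sup_eq_top]; trivial
  obtain ⟨_, ⟨m, rfl⟩, v, hv, rfl⟩ := AddSubgroup.mem_sup.1 hw'
  change p ^ (j + 1) • (m • c + v) = p ^ j • c at hw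
  have h1 : p ^ (j + 1) • v = 0 := by
    refine AddSubgroup.disjoint_def.1 hK.disjoint ?_ (K.nsmul_mem hv _)
    have : p ^ (j + 1) • v = p ^ j • c - p ^ (j + 1) • (m • c) := by
      rw [← hw, smul_add]; abel
    rw [this]
    have hcm := AddSubgroup.mem_zmultiples c
    exact sub_mem (nsmul_mem hcm _) (nsmul_mem (zsmul_mem hcm _) _)
  rw [smul_add, h1, add_zero] at hw
  -- Multiplying `hw` by `p^(e-1-j)` turns its left side into a multiple of `p^e c = 0`.
  have h2 : p ^ (e - 1) • c = 0 := by
    have : e - 1 = (e - 1 - j) + j := by omega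
    rw [this, pow_add, mul_smul, ← hw, ← mul_smul, ← pow_add,
      show e - 1 - j + (j + 1) = e by omega, smul_comm, h0, smul_zero]
  have h3 := addOrderOf_dvd_of_nsmul_eq_zero h2
  rw [hc, Nat.pow_dvd_pow_iff_le_right hp.out.one_lt] at h3
  omega

/-- An element of order `p` and height `h` yields a cyclic summand of order `p ^ (h + 1)`. -/
lemma hasCyclicSummand_of_socle {h : ℕ} {w : G} (h0 : p ^ (h + 1) • w = 0)
    (h1 : ∀ v : G, p ^ (h + 1) • v ≠ p ^ h • w) : HasCyclicSummandOfExponent p G (h + 1) :=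
  hasCyclicSummand_of_pure h0 fun j hj v => by
    obtain rfl : j = h := by omega
    exact h1 v

/-- If multiplying `s` by `p` raises its height by more than one, then `s` of height `h` yields a
cyclic summand of order `p ^ (h + 1)`. -/
lemma hasCyclicSummand_of_height_jump {h : ℕ} {s w : G} (hs : p ^ h • w = s)
    (hs' : ∀ v : G, p ^ (h + 1) • v ≠ s) (hj : ∃ v : G, p ^ (h + 2) • v = p • s) :
    HasCyclicSummandOfExponent p G (h + 1) := by
  obtain ⟨v, hv⟩ := hj
  -- `p^h (w - p v) = s - p^(h+1) v` is killed by `p` and still has height `h`.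
  apply hasCyclicSummand_of_socle (w := w - p • v)
  · rw [smul_sub, pow_succ', mul_smul, hs, ← hv, ← mul_smul,
      show p ^ (h + 2) = p * p ^ h * p by ring, sub_self]
  · intro v' hv'
    apply hs' (v' + v)
    rw [smul_add, hv', smul_sub, hs, ← mul_smul, ← pow_succ, sub_add_cancel]

end Summands

/-! ### Extending maps from `⟨x⟩`, and obstructions. -/

section Extensions

lemma zmultiples_mem_Q {p n : ℕ} {x : G} (h0 : p ^ n • x = 0)
    (h : ∀ y : G, p ^ n • y = 0 → ∃ g : G →+ G, g x = y) : AddSubgroup.zmultiples x ∈ Q G := by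
  intro f
  let x' : AddSubgroup.zmultiples x := ⟨x, AddSubgroup.mem_zmultiples x⟩
  have hx' : p ^ n • x' = 0 := Subtype.ext h0
  obtain ⟨g, hg⟩ := h (f x') (by rw [← map_nsmul, hx', map_zero])
  refine ⟨g, ?_⟩
  rintro ⟨_, k, rfl⟩
  have : (⟨(fun m : ℤ => m • x) k, ⟨k, rfl⟩⟩ : AddSubgroup.zmultiples x) = k • x' := rfl
  rw [this, map_zsmul, ← hg, ← map_zsmul]
  rfl

lemma exists_endo_of_zmultiples_mem_P {x y : G} (h : AddSubgroup.zmultiples x ∈ P G)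
    (hxy : addOrderOf x = addOrderOf y) : ∃ g : G →+ G, g x = y := by
  let x' : AddSubgroup.zmultiples x := ⟨x, AddSubgroup.mem_zmultiples x⟩
  have hx' : addOrderOf x' = addOrderOf x := AddSubgroup.addOrderOf_mk ..
  have hgen : ∀ w, w ∈ AddSubgroup.zmultiples x' := by
    rintro ⟨_, k, rfl⟩
    exact ⟨k, rfl⟩
  have hdvd : addOrderOf y ∣ addOrderOf x' := by rw [hx', hxy]
  let f := addMonoidHomOfForallMemZMultiples hgen hdvd
  have hf : f x' = y := addMonoidHomOfForallMemZMultiples_apply_gen hgen hdvd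
  obtain ⟨g, hg⟩ := h f (by
    rw [injective_iff_map_eq_zero]
    intro w hw
    obtain ⟨k, rfl⟩ := hgen w
    change f (k • x') = 0 at hw
    change k • x' = 0
    rw [map_zsmul, hf] at hw
    rwa [← addOrderOf_dvd_iff_zsmul_eq_zero, hx', hxy, addOrderOf_dvd_iff_zsmul_eq_zero])
  exact ⟨g, (hg x').trans hf⟩

variable {p : ℕ} [hp : Fact p.Prime]

lemma exists_endo_of_pure {n : ℕ} {x y : G}
    (hx : ∀ j, j + 1 = n → ∀ w : G, p ^ n • w ≠ p ^ j • x) (hy : p ^ n • y = 0) :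
    ∃ g : G →+ G, g x = y := by
  obtain ⟨ψ, hψ⟩ := exists_hom_zmod_eq_one p n x hx
  obtain ⟨f, hf⟩ := exists_zmod_hom_apply_one _ y hy
  refine ⟨f.comp ψ, ?_⟩
  have := hf 1
  rw [Int.cast_one, one_zsmul] at this
  rw [AddMonoidHom.comp_apply, hψ, this]

/-- Baer's decomposition for an Ulm sequence with one non-trivial gap: `x = a + p ^ l b` with
`⟨a⟩ ⊕ ⟨b⟩` a summand, given by its coordinate functions. -/
lemma exists_coordinates {k l d : ℕ} {x b : G} (hl : 1 ≤ l)
    (h0 : p ^ (k + d + 1) • x = 0) (hb : p ^ (k + l) • b = p ^ k • x)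
    (hx : ∀ w : G, p ^ (k + d + 1 + l) • w ≠ p ^ (k + d) • x)
    (ha : ∀ j, j + 1 = k → ∀ w : G, p ^ k • w ≠ p ^ j • x) :
    ∃ (a b : G) (α : G →+ ZMod (p ^ k)) (β : G →+ ZMod (p ^ (k + d + 1 + l))),
      x = a + p ^ l • b ∧ α a = 1 ∧ α b = 0 ∧ β a = 0 ∧ β b = 1 := by
  set N := k + d + 1 + l with hN
  have hb0 : p ^ N • b = 0 := by
    rw [show N = (d + 1) + (k + l) by omega, pow_add, mul_smul, hb, ← mul_smul, ← pow_add,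
      show d + 1 + k = k + d + 1 by ring, h0]
  obtain ⟨ψ, hψ⟩ := exists_hom_zmod_eq_one p N b (by
    intro j hj w hw
    apply hx w
    rw [hw, show j = d + (k + l) by omega, pow_add, mul_smul, hb, ← mul_smul, ← pow_add, add_comm d])
  obtain ⟨s, hs⟩ := ZMod.intCast_surjective (ψ (x - p ^ l • b))
  have hka : p ^ k • (x - p ^ l • b) = 0 := by
    rw [smul_sub, ← mul_smul, ← pow_add, hb, sub_self]
  have hdvd : ((p : ℤ) ^ (d + 1 + l)) ∣ s := by
    have h1 : p ^ k • ψ (x - p ^ l • b) = 0 := by rw [← map_nsmul, hka, map_zero]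
    rw [← hs, nsmul_eq_mul, ← Int.cast_natCast, ← Int.cast_mul,
      ZMod.intCast_zmod_eq_zero_iff_dvd _ (p ^ N)] at h1
    push_cast at h1
    rw [show N = k + (d + 1 + l) by omega, pow_add] at h1
    exact Int.dvd_of_mul_dvd_mul_left (pow_ne_zero _ (by exact_mod_cast hp.out.ne_zero)) h1
  obtain ⟨t, rfl⟩ := hdvd
  have hpN : ((p : ZMod (p ^ N))) ^ N = 0 := by
    rw [← Nat.cast_pow, ZMod.natCast_self]
  obtain ⟨v, hv⟩ : IsUnit (1 + (p : ZMod (p ^ N)) ^ (d + 1) * (t : ZMod (p ^ N))) := by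
    apply IsNilpotent.isUnit_one_add
    apply Commute.isNilpotent_mul_right (Commute.all _ _)
    exact IsNilpotent.pow_of_pos ⟨N, hpN⟩ (by omega)
  -- Moving the `ψ`-coordinate of `x - p^l b` over to `b` keeps the sum equal to `x`, and only
  -- multiplies `ψ b = 1` by the unit `v`.
  set a₁ := x - p ^ l • b - ((p : ℤ) ^ (d + 1 + l) * t) • b with ha₁
  set b₁ := b + ((p : ℤ) ^ (d + 1) * t) • b with hb₁
  have hsum : x = a₁ + p ^ l • b₁ := by
    rw [ha₁, hb₁, smul_add, ← natCast_zsmul (_ • b), ← mul_smul]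
    rw [show ((p ^ l : ℕ) : ℤ) * ((p : ℤ) ^ (d + 1) * t) = (p : ℤ) ^ (d + 1 + l) * t by
      push_cast; ring]
    abel
  clear_value a₁ b₁
  -- As `l ≥ 1`, the summand `p^(j+l) b₁` lies in `p^k G`, so `p^j a₁` is no more divisible than
  -- `p^j x`.
  obtain ⟨φ, hφ⟩ := exists_hom_zmod_eq_one p k a₁ (by
    intro j hj w hw
    apply ha j hj (w + p ^ (l - 1) • b₁)
    rw [hsum, smul_add, hw, smul_add, ← mul_smul _ _ b₁, ← mul_smul _ _ b₁, ← pow_add, ← pow_add,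
      show k + (l - 1) = j + l by omega])
  let β : G →+ ZMod (p ^ N) := (AddMonoidHom.mulLeft (↑v⁻¹ : ZMod (p ^ N))).comp ψ
  have hβa : β a₁ = 0 := by
    have : ψ a₁ = 0 := by
      rw [ha₁, map_sub, ← hs, map_zsmul, hψ, zsmul_one, sub_self]
    simp [β, this]
  have hβb : β b₁ = 1 := by
    have : ψ b₁ = v := by
      rw [hb₁, map_add, map_zsmul, hψ, zsmul_one, hv]
      push_cast; rfl
    simp [β, this]
  have hb₁0 : p ^ N • b₁ = 0 := by
    rw [hb₁, smul_add, hb0, smul_comm, hb0, smul_zero, add_zero]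
  obtain ⟨f, hf⟩ := exists_zmod_hom_apply_one _ b₁ hb₁0
  have hf1 : f 1 = b₁ := by simpa using hf 1
  -- Composing with the projection `id - f ∘ β` makes `φ` vanish on `b₁` without changing its value
  -- at `a₁`.
  refine ⟨a₁, b₁, φ.comp (AddMonoidHom.id G - f.comp β), β, hsum, ?_, ?_, hβa, hβb⟩
  · simp [hβa, hφ]
  · simp [hβb, hf1]

/-- Send `a ↦ y - p^l z` and `b ↦ z`; `hz` says that the first image is killed by `p^k`. -/
lemma exists_endo_of_one_gap {k l d : ℕ} {x y b z : G} (hl : 1 ≤ l)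
    (h0 : p ^ (k + d + 1) • x = 0) (hb : p ^ (k + l) • b = p ^ k • x)
    (hx : ∀ w : G, p ^ (k + d + 1 + l) • w ≠ p ^ (k + d) • x)
    (ha : ∀ j, j + 1 = k → ∀ w : G, p ^ k • w ≠ p ^ j • x)
    (hy : p ^ (k + d + 1) • y = 0) (hz : p ^ (k + l) • z = p ^ k • y) :
    ∃ g : G →+ G, g x = y := by
  obtain ⟨a, b, α, β, hxab, hαa, hαb, hβa, hβb⟩ := exists_coordinates hl h0 hb hx ha
  obtain ⟨f₁, hf₁⟩ := exists_zmod_hom_apply_one (p ^ k) (y - p ^ l • z) (by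
    rw [smul_sub, ← mul_smul, ← pow_add, hz, sub_self])
  obtain ⟨f₂, hf₂⟩ := exists_zmod_hom_apply_one (p ^ (k + d + 1 + l)) z (by
    rw [show p ^ (k + d + 1 + l) = p ^ (d + 1) * p ^ (k + l) by ring, mul_smul, hz, ← mul_smul,
      ← pow_add, show d + 1 + k = k + d + 1 by ring, hy])
  have h1 : f₁ 1 = y - p ^ l • z := by simpa using hf₁ 1
  have h2 : f₂ 1 = z := by simpa using hf₂ 1
  refine ⟨f₁.comp α + f₂.comp β, ?_⟩
  rw [hxab]
  simp only [map_add, map_nsmul, AddMonoidHom.add_apply, AddMonoidHom.comp_apply, hαa, hαb, hβa,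
    hβb, h1, h2, map_zero, add_zero, zero_add, sub_add_cancel]

/-- Without cyclic summands of exponents between `k + 1` and `n + l - 1`, every `y` of exponent at
most `n` has `p ^ i y` of height at least `i + l` for `k ≤ i ≤ n`. -/
lemma exists_pow_smul_eq_of_no_summand {k l n : ℕ} (hkn : k ≤ n)
    (hS : ∀ e, k + 1 ≤ e → e ≤ n + l - 1 → ¬ HasCyclicSummandOfExponent p G e)
    {y : G} (hy : p ^ n • y = 0) : ∃ z : G, p ^ (k + l) • z = p ^ k • y := by
  classical
  refine Nat.decreasingInduction' (P := fun i => ∃ z : G, p ^ (i + l) • z = p ^ i • y)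
    ?_ hkn ⟨0, by rw [hy, smul_zero]⟩
  rintro i hin hki ⟨v, hv⟩
  by_contra hcon
  have hex : ∃ m, ∀ z : G, p ^ m • z ≠ p ^ i • y := ⟨i + l, by simpa using hcon⟩
  have hle : Nat.find hex ≤ i + l := Nat.find_min' hex (by simpa using hcon)
  have hlt : i < Nat.find hex := by
    by_contra! h
    apply Nat.find_spec hex (p ^ (i - Nat.find hex) • y)
    rw [← mul_smul, ← pow_add, Nat.add_sub_cancel' h]
  obtain ⟨h, hh⟩ : ∃ h, Nat.find hex = h + 1 := ⟨Nat.find hex - 1, by omega⟩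
  have hmin := Nat.find_min hex (m := h) (by omega)
  push Not at hmin
  obtain ⟨w, hw⟩ := hmin
  have hspec := Nat.find_spec hex
  rw [hh] at hspec
  -- Here `i ≤ h < i + l` and `k ≤ i < n`, so `h + 1` lies in the forbidden range.
  refine hS (h + 1) (by omega) (by omega) (hasCyclicSummand_of_height_jump hw hspec ?_)
  refine ⟨p ^ (i + 1 + l - (h + 2)) • v, ?_⟩
  rw [← mul_smul, ← pow_add, Nat.add_sub_cancel' (by omega), hv, pow_succ', mul_smul]

/-- With `c` a generator of the summand, test `y = x + c` if `e < n` and `y = p^(e-n) c` otherwise: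
`p^k y = p^(k+l) g(b)` would make a multiple of `c` too divisible. No gap before `k` is needed. -/
lemma not_hasCyclicSummand_of_forall_exists_endo {k l e n : ℕ} {x b : G}
    (hP : ∀ y : G, addOrderOf y = p ^ n → ∃ g : G →+ G, g x = y)
    (hx : addOrderOf x = p ^ n) (hkn : k < n) (hl : 1 ≤ l) (hb : p ^ (k + l) • b = p ^ k • x)
    (hke : k + 1 ≤ e) (hen : e ≤ n + l - 1) : ¬ HasCyclicSummandOfExponent p G e := by
  intro hS
  obtain ⟨c, hc0, hc⟩ := hS.exists_generator
  have hx0 : p ^ n • x = 0 := by rw [← hx, addOrderOf_nsmul_eq_zero]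
  have hdiv : ∀ g : G →+ G, p ^ k • g x = p ^ (k + l) • g b := fun g => by
    rw [← map_nsmul, ← hb, map_nsmul]
  by_cases hlt : e < n
  · have hcn : ∀ j, e ≤ j → p ^ j • c = 0 := fun j hj => by
      rw [← Nat.sub_add_cancel hj, pow_add, mul_smul, hc0, smul_zero]
    have hord : addOrderOf (x + c) = p ^ n := by
      refine addOrderOf_eq_pow (by rw [smul_add, hx0, hcn _ hlt.le, add_zero]) fun j hj h => ?_
      rw [smul_add, hcn j (by omega), add_zero] at h
      have := addOrderOf_dvd_of_nsmul_eq_zero h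
      rw [hx, Nat.pow_dvd_pow_iff_le_right hp.out.one_lt] at this
      omega
    obtain ⟨g, hg⟩ := hP _ hord
    have h1 := hdiv g
    rw [hg, smul_add, ← hb] at h1
    apply hc k hke (p ^ (l - 1) • (g b - b))
    rw [← mul_smul, ← pow_add, show k + 1 + (l - 1) = k + l by omega, smul_sub, ← h1,
      add_sub_cancel_left]
  · obtain ⟨r, rfl⟩ := Nat.exists_eq_add_of_le (not_lt.1 hlt)
    have hord : addOrderOf (p ^ r • c) = p ^ n := by
      refine addOrderOf_eq_pow (by rw [← mul_smul, ← pow_add, hc0]) fun j hj h => ?_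
      apply hc (j + r) (by omega) 0
      rw [smul_zero, pow_add, mul_smul, h]
    obtain ⟨g, hg⟩ := hP _ hord
    have h1 := hdiv g
    rw [hg, ← mul_smul, ← pow_add] at h1
    apply hc (k + r) (by omega) (p ^ (l - (r + 1)) • g b)
    rw [h1, ← mul_smul, ← pow_add, show k + r + 1 + (l - (r + 1)) = k + l by omega]

end Extensions

/-! ### From ordinal heights to natural numbers. -/

section Heights

variable {p : ℕ}

lemma mem_pPow_natCast (m : ℕ) (y : G) :
    y ∈ pPow p G (m : Ordinal.{u}) ↔ ∃ w : G, p ^ m • w = y := by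
  induction m generalizing y with
  | zero => simp [pPow, Ordinal.limitRecOn_zero]
  | succ m ih =>
    have h : pPow p G ((m + 1 : ℕ) : Ordinal.{u}) =
        (pPow p G (m : Ordinal.{u})).map (nsmulAddMonoidHom (α := G) p) := by
      rw [Nat.cast_succ]
      exact Ordinal.limitRecOn_add_one ..
    rw [h, AddSubgroup.mem_map]
    constructor
    · rintro ⟨v, hv, rfl⟩
      obtain ⟨w, rfl⟩ := (ih v).1 hv
      exact ⟨w, by rw [pow_succ', mul_smul]; rfl⟩
    · rintro ⟨w, rfl⟩
      exact ⟨p ^ m • w, (ih _).2 ⟨w, rfl⟩, by rw [pow_succ', mul_smul]; rfl⟩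

lemma height_eq_natCast {m : ℕ} {y : G} (h : ∃ w : G, p ^ m • w = y)
    (h' : ∀ w : G, p ^ (m + 1) • w ≠ y) : height p y = (m : WithTop Ordinal.{u}) := by
  have hm : y ∉ pPow p G ((m : Ordinal.{u}) + 1) := by
    rw [← Nat.cast_succ, mem_pPow_natCast]
    simpa using h'
  rw [height, if_neg fun hall => hm (hall _)]
  have : sInf {σ : Ordinal.{u} | y ∉ pPow p G (σ + 1)} = m := by
    apply le_antisymm (csInf_le' hm)
    refine le_csInf ⟨_, hm⟩ fun σ hσ => ?_
    by_contra! hlt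
    obtain ⟨j, rfl⟩ := Ordinal.lt_omega0.1 (hlt.trans (Ordinal.natCast_lt_omega0 m))
    have hj : j < m := by exact_mod_cast hlt
    apply hσ
    rw [← Nat.cast_succ, mem_pPow_natCast]
    obtain ⟨w, rfl⟩ := h
    exact ⟨p ^ (m - (j + 1)) • w, by rw [← mul_smul, ← pow_add, Nat.add_sub_cancel' hj]⟩
  rw [this]
  rfl

lemma height_zero : height p (0 : G) = ⊤ := by
  rw [height, if_pos fun σ => zero_mem _]

lemma exists_height_of_notMem_firstUlm {y : G} (hy : y ∉ firstUlm p G) :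
    ∃ m : ℕ, (∃ w : G, p ^ m • w = y) ∧ ∀ w : G, p ^ (m + 1) • w ≠ y := by
  classical
  have hex : ∃ m, ∀ w : G, p ^ m • w ≠ y := by
    by_contra! h
    apply hy
    simp only [firstUlm, AddSubgroup.mem_iInf]
    exact fun m _ => h m
  have h0 : Nat.find hex ≠ 0 := fun h => by
    have := Nat.find_spec hex y
    rw [h] at this
    simp at this
  obtain ⟨m, hm⟩ := Nat.exists_eq_succ_of_ne_zero h0
  have hmin := Nat.find_min hex (m := m) (by omega)
  push Not at hmin
  have hspec := Nat.find_spec hex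
  rw [hm] at hspec
  exact ⟨m, hmin, hspec⟩

/-- Beyond `n` there are no gaps, as `⊤ + 1 < ⊤` fails; `k = n` is the trivial gap. -/
lemma hasNontrivialGapBefore_iff {n k : ℕ} {x : G} {H : ℕ → ℕ} (hx : p ^ n • x = 0)
    (hH : ∀ i < n, height p (p ^ i • x) = (H i : WithTop Ordinal.{u})) :
    HasNontrivialGapBefore (ulmSeq p x) n k ↔
      k < n ∧ (k = 0 → 0 < H 0) ∧ ∀ j, k = j + 1 → H j + 1 < H k := by
  have htop : ∀ i, n ≤ i → height p (p ^ i • x) = ⊤ := fun i hi => by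
    rw [← Nat.sub_add_cancel hi, pow_add, mul_smul, hx, smul_zero, height_zero]
  obtain hk | rfl | hk := lt_trichotomy k n
  · obtain _ | j := k
    · have h1 := hH 0 hk
      simp only [HasNontrivialGapBefore, HasGapBefore, ulmSeq, h1]
      have : (0 : WithTop Ordinal.{u}) < (H 0 : WithTop Ordinal.{u}) ↔ 0 < H 0 := by
        exact_mod_cast Iff.rfl
      rw [this]
      exact ⟨fun h => ⟨hk, fun _ => h.1, by omega⟩, fun h => ⟨h.2.1 trivial, hk.ne⟩⟩
    · have h1 := hH j (by omega)
      have h2 := hH (j + 1) hk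
      simp only [HasNontrivialGapBefore, HasGapBefore, ulmSeq, h1, h2]
      have : (H j + 1 : WithTop Ordinal.{u}) < (H (j + 1) : WithTop Ordinal.{u}) ↔
          H j + 1 < H (j + 1) := by
        exact_mod_cast Iff.rfl
      rw [this]
      exact ⟨fun h => ⟨hk, by omega, fun i hi => by cases hi; exact h.1⟩,
        fun h => ⟨h.2.2 j rfl, hk.ne⟩⟩
  · simp [HasNontrivialGapBefore]
  · obtain ⟨j, rfl⟩ : ∃ j, k = j + 1 := ⟨k - 1, by omega⟩
    simp only [HasNontrivialGapBefore, HasGapBefore, ulmSeq, htop j (by omega)]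
    simp [hk.le]

end Heights

/-! ### Gap conditions versus extendability. -/

section Gaps

variable {p : ℕ} [hp : Fact p.Prime]

lemma heights_eq_of_no_gap {m n k : ℕ} {H : ℕ → ℕ}
    (hmono : ∀ i, i + 1 < n → H i + 1 ≤ H (i + 1))
    (hgap : ∀ j, k < j → j ≤ m → ¬ ∀ i, j = i + 1 → H i + 1 < H j) (hm : m < n) :
    ∀ i, k ≤ i → i ≤ m → H i = H k + (i - k) := by
  intro i hki
  induction i, hki using Nat.le_induction with
  | base => simp
  | succ i hki ih =>
    intro him
    have h1 := ih (by omega)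
    have h2 := hmono i (by omega)
    have h3 := hgap (i + 1) (by omega) him
    push Not at h3
    obtain ⟨i', h, h4⟩ := h3
    obtain rfl : i = i' := by omega
    omega

/-- At most one non-trivial gap, together with the absence of the relevant cyclic summands,
lets `x` be mapped to every element killed by `p ^ n`. -/
lemma exists_endo_of_gap_condition {n : ℕ} {x y : G} {H : ℕ → ℕ} (hx0 : p ^ n • x = 0)
    (hH : ∀ i < n, ∃ w : G, p ^ H i • w = p ^ i • x)
    (hH' : ∀ i < n, ∀ w : G, p ^ (H i + 1) • w ≠ p ^ i • x)
    (hmono : ∀ i, i + 1 < n → H i + 1 ≤ H (i + 1))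
    (huniq : ∀ k k', (k < n ∧ (k = 0 → 0 < H 0) ∧ ∀ j, k = j + 1 → H j + 1 < H k) →
      (k' < n ∧ (k' = 0 → 0 < H 0) ∧ ∀ j, k' = j + 1 → H j + 1 < H k') → k = k')
    (hS : ∀ k l, (k < n ∧ (k = 0 → 0 < H 0) ∧ ∀ j, k = j + 1 → H j + 1 < H k) → H k = k + l →
      ∀ e, k + 1 ≤ e → e ≤ n + l - 1 → ¬ HasCyclicSummandOfExponent p G e)
    (hy : p ^ n • y = 0) : ∃ g : G →+ G, g x = y := by
  have hlow : ∀ m, m < n → (∀ k ≤ m, ¬ (k < n ∧ (k = 0 → 0 < H 0) ∧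
      ∀ j, k = j + 1 → H j + 1 < H k)) → H m = m := by
    intro m hm h
    have h0 := h 0 (by omega)
    have h1 := heights_eq_of_no_gap hmono (k := 0) (m := m)
      (fun j hj hjm hh => h j hjm ⟨by omega, by omega, hh⟩) hm m (by omega) le_rfl
    have : H 0 = 0 := by
      by_contra hne
      exact h0 ⟨by omega, fun _ => by omega, by omega⟩
    omega
  by_cases hex : ∃ k, k < n ∧ (k = 0 → 0 < H 0) ∧ ∀ j, k = j + 1 → H j + 1 < H k
  · obtain ⟨k, hk⟩ := hex
    have hone : ∀ j, j ≠ k → ¬ (j < n ∧ (j = 0 → 0 < H 0) ∧ ∀ i, j = i + 1 → H i + 1 < H j) :=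
      fun j hj h => hj (huniq j k h hk)
    have hHj : ∀ j, j + 1 = k → H j = j := fun j hj =>
      hlow j (by omega) fun i hi => hone i (by omega)
    have hgt : k < H k := by
      obtain _ | j := k
      · exact hk.2.1 rfl
      · have h1 := hk.2.2 j rfl
        rw [hHj j rfl] at h1
        exact h1
    obtain ⟨l, hl⟩ : ∃ l, H k = k + l := ⟨H k - k, by omega⟩
    obtain ⟨d, rfl⟩ : ∃ d, n = k + d + 1 := ⟨n - k - 1, by omega⟩
    have hlast : H (k + d) = k + d + l := by
      rw [heights_eq_of_no_gap hmono (k := k) (m := k + d)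
        (fun j hj hjm hh => hone j (by omega) ⟨by omega, by omega, hh⟩) (by omega) (k + d)
        (by omega) le_rfl, hl]
      omega
    obtain ⟨b, hb⟩ := hH k hk.1
    obtain ⟨z, hz⟩ := exists_pow_smul_eq_of_no_summand hk.1.le (hS k l hk hl) hy
    refine exists_endo_of_one_gap (by omega) hx0 (hl ▸ hb) (fun w => ?_) (fun j hj w => ?_) hy hz
    · have := hH' (k + d) (by omega) w
      rwa [hlast, show k + d + l + 1 = k + d + 1 + l by ring] at this
    · have := hH' j (by omega) w
      rwa [hHj j hj, hj] at this
  · refine exists_endo_of_pure (fun j hj w => ?_) hy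
    have := hH' j (by omega) w
    rwa [hlow j (by omega) fun k _ h => hex ⟨k, h⟩, hj] at this

/-- Two non-trivial gaps yield a cyclic summand that obstructs an extension. -/
lemma gap_le_of_forall_exists_endo {n k k' : ℕ} {x : G} {H : ℕ → ℕ}
    (hP : ∀ y : G, addOrderOf y = p ^ n → ∃ g : G →+ G, g x = y)
    (hx : addOrderOf x = p ^ n)
    (hH : ∀ i < n, ∃ w : G, p ^ H i • w = p ^ i • x)
    (hH' : ∀ i < n, ∀ w : G, p ^ (H i + 1) • w ≠ p ^ i • x)
    (hgt : ∀ i, k ≤ i → i < n → i < H i)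
    (hk' : k' < n ∧ ∀ j, k' = j + 1 → H j + 1 < H k') : k' ≤ k := by
  by_contra! hlt
  obtain ⟨j, rfl⟩ : ∃ j, k' = j + 1 := ⟨k' - 1, by omega⟩
  have hj := hgt j (by omega) (by omega)
  have hj' := hk'.2 j rfl
  obtain ⟨w, hw⟩ := hH j (by omega)
  obtain ⟨v, hv⟩ := hH (j + 1) hk'.1
  have hS : HasCyclicSummandOfExponent p G (H j + 1) :=
    hasCyclicSummand_of_height_jump hw (hH' j (by omega))
      ⟨p ^ (H (j + 1) - (H j + 2)) • v, by
        rw [← mul_smul, ← pow_add, Nat.add_sub_cancel' (by omega), hv, pow_succ', mul_smul]⟩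
  -- Applied at the index `j` just before the second gap, where `H j > j` already; `H j + 1 ≤ n + (H
  -- j - j) - 1` because `j + 1 < n`.
  refine not_hasCyclicSummand_of_forall_exists_endo (k := j) (l := H j - j) (b := w) hP hx
    (by omega) (by omega) ?_ (by omega) (by omega) hS
  rw [Nat.add_sub_cancel' hj.le, hw]

end Gaps

end AbPGroup

/-! ### The equivalence. -/

open AbPGroup in
theorem theorem3p14 (p : ℕ) [Fact p.Prime] (G : Type*) [AddCommGroup G]
    (hG : AbPGroup.IsAddPGroup p G) (x : G) (n : ℕ) (hx : addOrderOf x = p ^ n)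
    (hx1 : AddSubgroup.zmultiples x ⊓ AbPGroup.firstUlm p G = ⊥) :
    List.TFAE [
      AddSubgroup.zmultiples x ∈ AbPGroup.Q G,
      AddSubgroup.zmultiples x ∈ AbPGroup.P G,
      (∀ k k' : ℕ, AbPGroup.HasNontrivialGapBefore (AbPGroup.ulmSeq p x) n k →
          AbPGroup.HasNontrivialGapBefore (AbPGroup.ulmSeq p x) n k' → k = k') ∧
        ∀ k l : ℕ, AbPGroup.HasNontrivialGapBefore (AbPGroup.ulmSeq p x) n k →
          AbPGroup.height p (p ^ k • x) = ((k + l : ℕ) : WithTop Ordinal) →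
          ∀ e : ℕ, k + 1 ≤ e → e ≤ n + l - 1 →
            ¬ AbPGroup.HasCyclicSummandOfExponent p G e] := by
  have hx0 : p ^ n • x = 0 := by rw [← hx, addOrderOf_nsmul_eq_zero]
  have hne : ∀ i < n, p ^ i • x ≠ 0 := fun i hi h => by
    have := addOrderOf_dvd_of_nsmul_eq_zero h
    rw [hx, Nat.pow_dvd_pow_iff_le_right (Fact.out : p.Prime).one_lt] at this
    omega
  have hfin : ∀ i, ∃ m : ℕ, i < n →
      (∃ w : G, p ^ m • w = p ^ i • x) ∧ ∀ w : G, p ^ (m + 1) • w ≠ p ^ i • x := by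
    intro i
    by_cases hi : i < n
    · obtain ⟨m, hm⟩ := exists_height_of_notMem_firstUlm (p := p) (y := p ^ i • x) fun hmem =>
        hne i hi ((AddSubgroup.mem_bot).1
          (hx1 ▸ ⟨nsmul_mem (AddSubgroup.mem_zmultiples x) _, hmem⟩))
      exact ⟨m, fun _ => hm⟩
    · exact ⟨0, fun h => absurd h hi⟩
  choose H hHH using hfin
  have hH : ∀ i < n, ∃ w : G, p ^ H i • w = p ^ i • x := fun i hi => (hHH i hi).1
  have hH' : ∀ i < n, ∀ w : G, p ^ (H i + 1) • w ≠ p ^ i • x := fun i hi => (hHH i hi).2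
  have hheight : ∀ i < n, height p (p ^ i • x) = (H i : WithTop Ordinal) := fun i hi =>
    height_eq_natCast (hH i hi) (hH' i hi)
  have hmono : ∀ i, i + 1 < n → H i + 1 ≤ H (i + 1) := by
    intro i hi
    by_contra! hlt
    obtain ⟨w, hw⟩ := hH i (by omega)
    apply hH' (i + 1) hi (p ^ (H i - H (i + 1)) • w)
    rw [← mul_smul, ← pow_add, show H (i + 1) + 1 + (H i - H (i + 1)) = H i + 1 by omega, pow_succ',
      mul_smul, hw, ← mul_smul, ← pow_succ']
  have hle : ∀ i, i < n → i ≤ H i := by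
    intro i
    induction i with
    | zero => omega
    | succ i ih =>
      intro hi
      have := hmono i hi
      have := ih (by omega)
      omega
  have hgap := fun k => hasNontrivialGapBefore_iff (k := k) hx0 hheight
  simp only [hgap]
  tfae_have 1 → 2 := fun h f _ => h f
  tfae_have 3 → 1 := by
    rintro ⟨huniq, hS⟩
    refine zmultiples_mem_Q hx0 fun y hy =>
      exists_endo_of_gap_condition hx0 hH hH' hmono huniq (fun k l hk hl => ?_) hy
    exact hS k l hk (by rw [hheight k hk.1, hl])
  tfae_have 2 → 3 := by
    intro hmem
    have hP : ∀ y : G, addOrderOf y = p ^ n → ∃ g : G →+ G, g x = y := fun y hy =>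
      exists_endo_of_zmultiples_mem_P hmem (hx.trans hy.symm)
    -- From a gap onwards heights exceed indices, which yields `l ≥ 1` and the hypothesis for
    -- excluding a second gap.
    have hgt : ∀ k, (k < n ∧ (k = 0 → 0 < H 0) ∧ ∀ j, k = j + 1 → H j + 1 < H k) →
        ∀ i, k ≤ i → i < n → i < H i := by
      intro k hk i hki
      induction i, hki using Nat.le_induction with
      | base =>
        intro _
        obtain _ | j := k
        · exact hk.2.1 rfl
        · have h1 := hk.2.2 j rfl
          have h2 := hle j (by omega)
          omega
      | succ i hki ih =>
        intro hi
        have h1 := hmono i hi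
        have h2 := ih (by omega)
        omega
    refine ⟨fun k k' hk hk' => le_antisymm ?_ ?_, fun k l hk hkl e hke hen => ?_⟩
    · exact gap_le_of_forall_exists_endo hP hx hH hH' (hgt k' hk') ⟨hk.1, hk.2.2⟩
    · exact gap_le_of_forall_exists_endo hP hx hH hH' (hgt k hk) ⟨hk'.1, hk'.2.2⟩
    · have hl : H k = k + l := by
        rw [hheight k hk.1] at hkl
        exact_mod_cast hkl
      have h1 := hgt k hk k le_rfl hk.1
      obtain ⟨b, hb⟩ := hH k hk.1
      exact not_hasCyclicSummand_of_forall_exists_endo hP hx hk.1 (by omega) (hl ▸ hb) hke hen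
  tfae_finish
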